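/- Fix $T\ge 0$, a time domain $I\subset[0,T]$ with $\{0,T\}\subset I$, and a number $d$ of assets. A \emph{financial experiment} consists of a measurable space $(\Omega,\mathcal F)$ with a filtration $(\mathcal F_t)_{t\in I}$ generating $\mathcal F$, probability measures $Q_1,\dots,Q_d\ll Q$ on $\mathcal F$ such that $\mathcal F_0$ is $Q$-trivial (each of its events has $Q$-probability $0$ or $1$), and adapted nonnegative, $Q$-almost surely positive discounted price processes $(X^i_t)_{t\in I}$, $1\le i\le d$, with $$\frac{dQ_{i|\mathcal F_t}}{dQ_{|\mathcal F_t}}=\frac{X^i_t}{X^i_0},\qquad t\in I,\ 1\le i\le d.$$ Put $Y_T=\big((X^i_s/X^i_0)_{i=1,\dots,d}\big)_{s\in I}$, a random element of $([0,\infty)^d)^I$ with its product $\sigma$-field. On this space let $\pi_t=(\pi^i_t)_{i\le d}$ be the coordinate projections and $\mathcal G_t=\sigma(\pi_s: s\in I,\ s\le t)$. A \emph{standard financial experiment} $\{\nu_1,\dots,\nu_d,\nu\}$ is a financial experiment on $([0,\infty)^d)^I$ with filtration $(\mathcal G_t)_{t\in I}$, price process $(\pi_t)_{t\in I}$ and $$\frac{d\nu_{i|\mathcal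 G_t}}{d\nu_{|\mathcal G_t}}=\pi^i_t,\qquad t\in I,\ 1\le i\le d.$$ For sequences of probability measures $P_n,P_n'$ on $(\Omega_n,\mathcal F_n)$ write $P_n\triangleleft P_n'$ if $P_n'(A_n)\to0$ implies $P_n(A_n)\to0$ for all $A_n\in\mathcal F_n$. \textbf{Theorem.} Let $E_n=(\Omega_n,\mathcal F_n,\{Q_{1,n},\dots,Q_{d,n},Q_n\})$, $(\mathcal F_{t,n})_{t\in I}$, $n\in\mathbb N$, be a sequence of financial experiments with the same $I$ and $d$, such that $Q_{i,n}\triangleleft Q_n$ and $Q_n\triangleleft Q_{i,n}$ for all $i=1,\dots,d$. Then there exist a standard financial experiment $\{\nu_1,\dots,\nu_d,\nu\}$ on $([0,\infty)^d)^I$ and a subnet of $(\mathbb N,\le)$, i.e. a nonempty directed set $(\mathcal I,\le)$ and a map $\tau\mapsto n_\tau$ from $\mathcal I$ to $\mathbb N$ that is eventually $\ge m$ for every $m\in\mathbb N$, such that for every finite $J\subset I$ the $J$-marginals of $\mathcal L(Y_{T,n_\tau}\mid Q_{i,n_\tau})$ converge weakly, along $\tau\in\mathcal I$, to the $J$-marginal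 of $\nu_i$, for all $i=1,\dots,d+1$, where $Q_{d+1,n}:=Q_n$ and $\nu_{d+1}:=\nu$. -/

import Mathlib

open MeasureTheory Filter Topology
open scoped NNReal ENNReal

/-- Contiguity `P ◁ Q` of two sequences of measures, where `P n` and `Q n` live on a space `Ω n`
that may vary with `n`: along any sequence of events, `Q n (A n) → 0` implies `P n (A n) → 0`. -/
def Contiguous {Ω : ℕ → Type*} [∀ n, MeasurableSpace (Ω n)]
    (P Q : ∀ n, Measure (Ω n)) : Prop :=
  ∀ A : ∀ n, Set (Ω n), (∀ n, MeasurableSet (A n)) →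
    Tendsto (fun n => Q n (A n)) atTop (𝓝 0) → Tendsto (fun n => P n (A n)) atTop (𝓝 0)

/-- A financial experiment with `d` discounted price processes, time domain `I` and initial
time `t₀`, on the measurable space `Ω`.

The real world measure only enters through its null sets, which are those of the equivalent
martingale measure `Q`; it is not recorded. -/
structure FinancialExperiment (I : Set ℝ) (t₀ : I) (d : ℕ) (Ω : Type*) [m : MeasurableSpace Ω] where
  /-- The filtration `(𝓕_t)`, `t ∈ I`. -/
  filt : Filtration I m
  /-- The whole σ-field is generated by the filtration. -/
  iSup_filt : ⨆ t, filt t = m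
  /-- The discounted price processes `X^i_t`, `i = 1, …, d`. -/
  price : I → Ω → Fin d → ℝ≥0
  /-- The prices are adapted. -/
  adapted : ∀ t, Measurable[filt t] (price t)
  /-- The measures `Q_1, …, Q_d`. -/
  Qi : Fin d → ProbabilityMeasure Ω
  /-- The martingale measure `Q`. -/
  Q : ProbabilityMeasure Ω
  /-- The prices are positive. -/
  price_pos : ∀ t i, ∀ᵐ ω ∂(Q : Measure Ω), 0 < price t ω i
  /-- The initial σ-field is trivial. -/
  trivial_start : ∀ A, MeasurableSet[filt t₀] A → (Q : Measure Ω) A = 0 ∨ (Q : Measure Ω) A = 1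
  /-- Each `Q_i` is absolutely continuous with respect to `Q`. -/
  ac : ∀ i, (Qi i : Measure Ω) ≪ (Q : Measure Ω)
  /-- `X^i_t / X^i_0` is the density of `Q_i` restricted to `𝓕_t` with respect to `Q` restricted
  to `𝓕_t`. -/
  density : ∀ i t, (Qi i : Measure Ω).trim (filt.le t) =
    ((Q : Measure Ω).trim (filt.le t)).withDensity
      (fun ω => ((price t ω i / price t₀ ω i : ℝ≥0) : ℝ≥0∞))

namespace FinancialExperiment

variable {I : Set ℝ} {t₀ : I} {d : ℕ} {Ω : Type*} [MeasurableSpace Ω]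

/-- The path `Y_T = ((X^i_s / X^i_0)_{i = 1, …, d})_{s ∈ I}` of the normalised prices, with values
in `([0,∞)^d)^I`. -/
noncomputable def Y (E : FinancialExperiment I t₀ d Ω) (ω : Ω) : I → Fin d → ℝ≥0 :=
  fun t i => E.price t ω i / E.price t₀ ω i

lemma measurable_Y (E : FinancialExperiment I t₀ d Ω) : Measurable E.Y := by
  have h : ∀ t, Measurable (E.price t) := fun t => (E.adapted t).mono (E.filt.le t) le_rfl
  refine measurable_pi_lambda _ fun t => measurable_pi_lambda _ fun i => ?_
  exact ((measurable_pi_apply i).comp (h t)).div ((measurable_pi_apply i).comp (h t₀))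

/-- The law `𝓛(Y_T | μ)` on `([0,∞)^d)^I` with its product σ-field. -/
noncomputable def lawY (E : FinancialExperiment I t₀ d Ω) (μ : ProbabilityMeasure Ω) :
    ProbabilityMeasure (I → Fin d → ℝ≥0) :=
  μ.map E.measurable_Y.aemeasurable

end FinancialExperiment

/-- The canonical filtration `𝓖_t = σ(π_s : s ∈ I, s ≤ t)` on `([0,∞)^d)^I`. -/
def coordFiltration (I : Set ℝ) (d : ℕ) :
    Filtration I (inferInstance : MeasurableSpace (I → Fin d → ℝ≥0)) :=
  Filtration.natural (fun t (x : I → Fin d → ℝ≥0) => x t)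
    (fun t => (measurable_pi_apply t).stronglyMeasurable)

/-- A financial experiment on `([0,∞)^d)^I` is standard if its filtration is the canonical one,
its price process is the process of projections `π_t`, and `π^i_t` is itself the density of
`ν_i` with respect to `ν` on `𝓖_t`. -/
def FinancialExperiment.IsStandard {I : Set ℝ} {t₀ : I} {d : ℕ}
    (S : FinancialExperiment I t₀ d (I → Fin d → ℝ≥0)) : Prop :=
  S.filt = coordFiltration I d ∧
  S.price = (fun t x => x t) ∧
  ∀ i t, (S.Qi i : Measure (I → Fin d → ℝ≥0)).trim ((coordFiltration I d).le t) =
    ((S.Q : Measure (I → Fin d → ℝ≥0)).trim ((coordFiltration I d).le t)).withDensity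
      (fun x => (x t i : ℝ≥0∞))

/-- The marginal on the finite set `J` of coordinates of a law on `([0,∞)^d)^I`. -/
noncomputable def finMarginal {I : Set ℝ} {d : ℕ} (J : Finset I)
    (μ : ProbabilityMeasure (I → Fin d → ℝ≥0)) : ProbabilityMeasure (J → Fin d → ℝ≥0) :=
  μ.map (Finset.measurable_restrict J).aemeasurable

/-- A map `φ` from a directed set `D` into `ℕ` defines a subnet of `(ℕ, ≤)` (in Kelley's sense) if
it is eventually above every `m`. -/
def IsSubnet {D : Type*} [Preorder D] (φ : D → ℕ) : Prop :=
  ∀ m : ℕ, ∃ a : D, ∀ b, a ≤ b → m ≤ φ b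

/-! Write `Y` for the normalised price path. Each coordinate of `Y` has `Q`-mean 1, so Markov's
inequality bounds its tails uniformly in `n`, and the finite-dimensional laws under `Q` are tight.
Prokhorov's theorem gives limits of all of them along one free ultrafilter on ℕ. These limits are
consistent, and Kolmogorov's extension theorem glues them into a law ν on path space
(`exists_tendsto_finMarginal_lawY`).

The two directions of contiguity play different roles. Since `Q_i ◁ Q`, the densities `Y t i` are
uniformly integrable under `Q`, so weak convergence survives multiplication by them: the laws under
`Q_i` of the coordinates up to time `t` converge to those of `π^i_t · ν`
(`tendsto_lintegral_finMarginal_Qi`). Any later time `t'` gives the same limit, so by uniqueness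
`π^i_t · ν` and `π^i_T · ν` agree on `𝓖_t`. This is the density identity of a standard experiment
with `ν_i = π^i_T · ν`. Since `Q ◁ Q_i`, no mass of `Y t i` under `Q` reaches 0 in the limit, so the
limit prices are ν-a.s. positive (`ae_pos_of_contiguous`).

An ultrafilter limit becomes a subnet limit by indexing with the pairs `n ∈ A ∈ U`. -/

/-! ### Kolmogorov's extension theorem -/

/-- The content of a decreasing sequence of measurable cylinders with empty intersection tends to
zero, for a projective family of finite measures on Polish spaces. -/
theorem tendsto_projectiveFamilyContent_zero {ι : Type*} {X : ι → Type*}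
    [∀ i, TopologicalSpace (X i)] [∀ i, PolishSpace (X i)] [∀ i, MeasurableSpace (X i)]
    [∀ i, BorelSpace (X i)] {P : ∀ J : Finset ι, Measure (∀ j : J, X j)}
    [∀ J, IsFiniteMeasure (P J)] (hP : IsProjectiveMeasureFamily P)
    {A : ℕ → Set (∀ i, X i)} (A_mem : ∀ n, A n ∈ measurableCylinders X) (A_anti : Antitone A)
    (A_inter : ⋂ n, A n = ∅) :
    Tendsto (fun n => projectiveFamilyContent hP (A n)) atTop (𝓝 0) := by
  have anti : Antitone fun n => projectiveFamilyContent hP (A n) := fun m n hmn =>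
    projectiveFamilyContent_mono hP (A_mem n) (A_mem m) (A_anti hmn)
  suffices H : ∀ ε : ℝ≥0∞, 0 < ε → ∃ n, projectiveFamilyContent hP (A n) ≤ ε by
    refine ENNReal.tendsto_atTop_zero.2 fun ε hε => ?_
    obtain ⟨n, hn⟩ := H ε hε
    exact ⟨n, fun m hm => (anti hm).trans hn⟩
  by_contra! hcon
  obtain ⟨ε, hε, hA⟩ := hcon
  have A_cyl n : ∃ s S, MeasurableSet S ∧ A n = cylinder s S :=
    (mem_measurableCylinders _).1 (A_mem n)
  choose s S mS A_eq using A_cyl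
  -- Inner regularity replaces each base `S n` by a compact `K n`, losing at most `δ n`; the total
  -- loss stays below `ε`, so finitely many of the compact cylinders always have a common point.
  obtain ⟨δ, δ_pos, hδ⟩ := ENNReal.exists_pos_sum_of_countable' hε.ne' ℕ
  have hK n : ∃ K ⊆ S n, IsCompact K ∧ IsClosed K ∧ P (s n) (S n \ K) < δ n :=
    (mS n).exists_isCompact_isClosed_sdiff_lt (measure_ne_top _ _) (δ_pos n).ne'
  choose K K_sub K_comp K_closed hK using hK
  have C_mem n : cylinder (s n) (K n) ∈ measurableCylinders X :=
    cylinder_mem_measurableCylinders _ _ (K_closed n).measurableSet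
  have diff_le n :
      projectiveFamilyContent hP (A n \ cylinder (s n) (K n)) ≤ δ n := by
    rw [A_eq, sdiff_cylinder_same, projectiveFamilyContent_cylinder hP
      ((mS n).diff (K_closed n).measurableSet)]
    exact (hK n).le
  have hne n : ∃ x, ∀ k ≤ n, x ∈ cylinder (s k) (K k) := by
    by_contra! hemp
    refine (hA n).not_ge ?_
    have hsub : A n ⊆ ⋃ k ∈ Finset.range (n + 1), (A k \ cylinder (s k) (K k)) := by
      intro x hx
      obtain ⟨k, hk, hxk⟩ := hemp x
      exact Set.mem_biUnion (Finset.mem_coe.2 (Finset.mem_range_succ_iff.2 hk))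
        ⟨A_anti hk hx, hxk⟩
    have hd k : A k \ cylinder (s k) (K k) ∈ measurableCylinders X :=
      sdiff_mem_measurableCylinders (A_mem k) (C_mem k)
    calc projectiveFamilyContent hP (A n)
      _ ≤ projectiveFamilyContent hP (⋃ k ∈ Finset.range (n + 1),
            (A k \ cylinder (s k) (K k))) :=
        projectiveFamilyContent_mono hP (A_mem n)
          (isSetRing_measurableCylinders.biUnion_mem _ fun k _ => hd k) hsub
      _ ≤ ∑ k ∈ Finset.range (n + 1),
            projectiveFamilyContent hP (A k \ cylinder (s k) (K k)) :=
        addContent_biUnion_le isSetRing_measurableCylinders fun k _ => hd k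
      _ ≤ ∑ k ∈ Finset.range (n + 1), δ k := Finset.sum_le_sum fun k _ => diff_le k
      _ ≤ ∑' k, δ k := ENNReal.sum_le_tsum _
      _ ≤ ε := hδ.le
  choose x hx using hne
  -- A free ultrafilter replaces the diagonal extraction: it makes all relevant coordinates of `x n`
  -- converge at once.
  have ev k : ∀ᶠ n in (hyperfilter ℕ : Filter ℕ), (s k).restrict (x n) ∈ K k :=
    ((eventually_ge_atTop k).filter_mono Nat.hyperfilter_le_atTop).mono fun n hn => hx n k hn
  -- Coordinates outside every `s k` do not affect membership in any `A k`, so they get the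
  -- arbitrary value `x 0 i`.
  have lim i : ∃ y, (∃ k, i ∈ s k) → Tendsto (fun n => x n i) (hyperfilter ℕ) (𝓝 y) := by
    by_cases hi : ∃ k, i ∈ s k
    · obtain ⟨k, hk⟩ := hi
      obtain ⟨y, -, hy⟩ := ((K_comp k).image (continuous_apply (⟨i, hk⟩ : s k))).ultrafilter_le_nhds'
        ((hyperfilter ℕ).map fun n => x n i)
        ((ev k).mono fun n hn => ⟨_, hn, rfl⟩)
      exact ⟨y, fun _ => hy⟩
    · exact ⟨x 0 i, fun h => absurd h hi⟩
  choose y hy using lim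
  have hyA : y ∈ ⋂ n, A n := by
    refine Set.mem_iInter.2 fun k => ?_
    rw [A_eq, mem_cylinder]
    exact K_sub k ((K_closed k).mem_of_tendsto
      (tendsto_pi_nhds.2 fun i => hy i ⟨k, i.2⟩) (ev k))
  rw [A_inter] at hyA
  exact hyA

/-- **Kolmogorov's extension theorem**: a projective family of finite measures on finite products
of Polish spaces has a projective limit. -/
theorem exists_isProjectiveLimit {ι : Type*} {X : ι → Type*}
    [∀ i, TopologicalSpace (X i)] [∀ i, PolishSpace (X i)] [∀ i, MeasurableSpace (X i)]
    [∀ i, BorelSpace (X i)] {P : ∀ J : Finset ι, Measure (∀ j : J, X j)}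
    [∀ J, IsFiniteMeasure (P J)] (hP : IsProjectiveMeasureFamily P) :
    ∃ μ : Measure (∀ i, X i), IsProjectiveLimit μ P := by
  have hsub : (projectiveFamilyContent hP).IsSigmaSubadditive :=
    isSigmaSubadditive_of_addContent_iUnion_eq_tsum isSetRing_measurableCylinders
      (addContent_iUnion_eq_sum_of_tendsto_zero isSetRing_measurableCylinders _
        (fun _ _ => projectiveFamilyContent_ne_top hP)
        (fun _ h₁ h₂ h₃ => tendsto_projectiveFamilyContent_zero hP h₁ h₂ h₃))
  refine ⟨(projectiveFamilyContent hP).measure isSetSemiring_measurableCylinders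
      generateFrom_measurableCylinders.ge hsub, fun J => ?_⟩
  ext S hS
  rw [Measure.map_apply (Finset.measurable_restrict J) hS, AddContent.measure_eq,
    ← cylinder, projectiveFamilyContent_cylinder hP hS]
  · exact generateFrom_measurableCylinders.symm
  · exact cylinder_mem_measurableCylinders _ _ hS

/-! ### Contiguity and uniform integrability -/

/-- Contiguity in its quantitative form. -/
lemma Contiguous.exists_forall_le {Ω : ℕ → Type*} [∀ n, MeasurableSpace (Ω n)]
    {P Q : ∀ n, Measure (Ω n)} (h : Contiguous P Q) {ε : ℝ≥0∞} (hε : ε ≠ 0) :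
    ∃ δ : ℝ≥0, 0 < δ ∧ ∀ᶠ n in atTop, ∀ A, MeasurableSet A → Q n A ≤ δ → P n A ≤ ε := by
  by_contra! hcon
  have hfreq : ∀ k : ℕ, ∃ᶠ n in atTop,
      ∃ A, MeasurableSet A ∧ Q n A ≤ ((k : ℝ≥0∞) + 1)⁻¹ ∧ ε < P n A := by
    intro k
    refine (hcon ((k : ℝ≥0) + 1)⁻¹ (by positivity)).mono ?_
    rintro n ⟨A, hA, hQ, hP⟩
    refine ⟨A, hA, hQ.trans_eq ?_, hP⟩
    rw [ENNReal.coe_inv (by positivity)]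
    simp
  obtain ⟨φ, hφ, hA⟩ := extraction_forall_of_frequently hfreq
  choose A mA hQ hP using hA
  -- The bad events `A k` live on `Ω (φ k)`. They are placed at the indices `φ k` of a full sequence
  -- that is empty elsewhere; `φ` is injective, so each index receives at most one of them.
  let B : ∀ n, Set (Ω n) := fun n => {ω | ∃ k, ∃ e : φ k = n, e ▸ ω ∈ A k}
  have hB k : B (φ k) = A k := by
    ext ω
    refine ⟨?_, fun hω => ⟨k, rfl, hω⟩⟩
    rintro ⟨l, e, hl⟩
    obtain rfl := hφ.injective e
    exact hl
  have hB' n (hn : n ∉ Set.range φ) : B n = ∅ :=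
    Set.eq_empty_of_forall_notMem fun ω ⟨k, e, _⟩ => hn ⟨k, e⟩
  have mB n : MeasurableSet (B n) := by
    by_cases hn : n ∈ Set.range φ
    · obtain ⟨k, rfl⟩ := hn
      rw [hB]
      exact mA k
    · rw [hB' n hn]
      exact .empty
  have hQB : Tendsto (fun n => Q n (B n)) atTop (𝓝 0) := by
    have hz : Tendsto (fun k : ℕ => ((k : ℝ≥0∞) + 1)⁻¹) atTop (𝓝 0) := by
      have := (tendsto_add_atTop_iff_nat 1).2 ENNReal.tendsto_inv_nat_nhds_zero
      simpa using this
    refine ENNReal.tendsto_atTop_zero.2 fun η hη => ?_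
    obtain ⟨N, hN⟩ := ENNReal.tendsto_atTop_zero.1 hz η hη
    refine ⟨φ N, fun n hn => ?_⟩
    by_cases hr : n ∈ Set.range φ
    · obtain ⟨k, rfl⟩ := hr
      rw [hB]
      exact (hQ k).trans (hN k (hφ.le_iff_le.1 hn))
    · simp [hB' n hr]
  have hPB := (h B mB hQB).comp hφ.tendsto_atTop
  obtain ⟨k, hk⟩ := (hPB.eventually_lt_const (pos_iff_ne_zero.2 hε)).exists
  rw [Function.comp_apply, hB] at hk
  exact lt_asymm hk (hP k)

/-- Weak convergence extends to continuous nonnegative functions that are uniformly integrable,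
multiplied by bounded continuous ones. -/
lemma tendsto_lintegral_mul_of_unifIntegrable {α X : Type*} {L : Filter α}
    [TopologicalSpace X] [MeasurableSpace X] [OpensMeasurableSpace X]
    {μs : α → ProbabilityMeasure X} {μ : ProbabilityMeasure X} (h : Tendsto μs L (𝓝 μ))
    {g : X → ℝ≥0} (hg : Continuous g)
    (hUI : ∀ ε : ℝ≥0∞, ε ≠ 0 →
      ∃ K : ℝ≥0, ∀ᶠ a in L, ∫⁻ x, ((g x - K : ℝ≥0) : ℝ≥0∞) ∂(μs a : Measure X) ≤ ε)
    (f : BoundedContinuousFunction X ℝ≥0) :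
    Tendsto (fun a => ∫⁻ x, (f x : ℝ≥0∞) * g x ∂(μs a : Measure X)) L
      (𝓝 (∫⁻ x, (f x : ℝ≥0∞) * g x ∂(μ : Measure X))) := by
  let G (K : ℝ≥0) : BoundedContinuousFunction X ℝ≥0 :=
    BoundedContinuousFunction.mkOfBound ⟨fun x => min (g x) K, hg.min continuous_const⟩ K
      fun x y => by
        have hx : ((min (g x) K : ℝ≥0) : ℝ) ≤ K := by exact_mod_cast min_le_right _ _
        have hy : ((min (g y) K : ℝ≥0) : ℝ) ≤ K := by exact_mod_cast min_le_right _ _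
        simp only [ContinuousMap.coe_mk, NNReal.dist_eq]
        rw [abs_le]
        constructor <;> linarith [NNReal.coe_nonneg (min (g x) K), NNReal.coe_nonneg (min (g y) K)]
  have hlim (K : ℝ≥0) := ProbabilityMeasure.tendsto_iff_forall_lintegral_tendsto.1 h (f * G K)
  have hG (K : ℝ≥0) (x : X) : (f * G K) x = f x * min (g x) K := rfl
  simp only [hG] at hlim
  obtain hL | hL := L.eq_or_neBot
  · rw [hL]
    exact tendsto_bot
  refine tendsto_of_le_liminf_of_limsup_le ?_ ?_
  -- Lower bound: the truncations `min g K` increase to `g`, and weak convergence applies to each of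
  -- them.
  · have hsup : ∫⁻ x, (f x : ℝ≥0∞) * g x ∂(μ : Measure X) =
        ⨆ K : ℕ, ∫⁻ x, ((f x * min (g x) K : ℝ≥0) : ℝ≥0∞) ∂(μ : Measure X) := by
      rw [← lintegral_iSup]
      · refine lintegral_congr fun x => le_antisymm ?_ (iSup_le fun K => ?_)
        · obtain ⟨K, hK⟩ := exists_nat_ge (g x)
          refine le_iSup_of_le K ?_
          rw [min_eq_left hK, ENNReal.coe_mul]
        · rw [← ENNReal.coe_mul]
          exact ENNReal.coe_le_coe.2 (mul_le_mul_right (min_le_left _ _) _)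
      · intro K
        exact (f.continuous.mul (hg.min continuous_const)).measurable.coe_nnreal_ennreal
      · intro K K' hK x
        have : (K : ℝ≥0) ≤ K' := by exact_mod_cast hK
        dsimp only
        gcongr
    rw [hsup]
    refine iSup_le fun K => ?_
    rw [← (hlim K).liminf_eq]
    refine liminf_le_liminf (.of_forall fun a => lintegral_mono fun x => ?_)
    rw [← ENNReal.coe_mul]
    exact ENNReal.coe_le_coe.2 (mul_le_mul_right (min_le_left _ _) _)
  · set C : ℝ≥0 := nndist f 0
    have hC x : f x ≤ C := BoundedContinuousFunction.NNReal.upper_bound f x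
    -- Upper bound: `g = min g K + (g - K)` with truncated subtraction, and uniform integrability
    -- makes the last term cost at most `C * ε`.
    have key : ∀ ε : ℝ≥0∞, ε ≠ 0 →
        limsup (fun a => ∫⁻ x, (f x : ℝ≥0∞) * g x ∂(μs a : Measure X)) L ≤
          ∫⁻ x, (f x : ℝ≥0∞) * g x ∂(μ : Measure X) + C * ε := by
      intro ε hε
      obtain ⟨K, hK⟩ := hUI ε hε
      have hle : ∀ᶠ a in L, ∫⁻ x, (f x : ℝ≥0∞) * g x ∂(μs a : Measure X) ≤
          ∫⁻ x, ((f x * min (g x) K : ℝ≥0) : ℝ≥0∞) ∂(μs a : Measure X) + C * ε := by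
        filter_upwards [hK] with a ha
        calc ∫⁻ x, (f x : ℝ≥0∞) * g x ∂(μs a : Measure X)
          _ ≤ ∫⁻ x, ((f x * min (g x) K : ℝ≥0) : ℝ≥0∞) + C * ((g x - K : ℝ≥0) : ℝ≥0∞)
                ∂(μs a : Measure X) := by
              refine lintegral_mono fun x => ?_
              have : g x = min (g x) K + (g x - K) := by
                rcases le_total (g x) K with hx | hx
                · rw [min_eq_left hx, tsub_eq_zero_of_le hx, add_zero]
                · rw [min_eq_right hx, add_tsub_cancel_of_le hx]
              have h2 : f x * g x ≤ f x * min (g x) K + C * (g x - K) := by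
                conv_lhs => rw [this, mul_add]
                gcongr
                exact hC x
              simp only [← ENNReal.coe_mul, ← ENNReal.coe_add]
              exact ENNReal.coe_le_coe.2 h2
          _ = ∫⁻ x, ((f x * min (g x) K : ℝ≥0) : ℝ≥0∞) ∂(μs a : Measure X) +
                C * ∫⁻ x, ((g x - K : ℝ≥0) : ℝ≥0∞) ∂(μs a : Measure X) := by
              rw [lintegral_add_left, lintegral_const_mul]
              · exact (hg.sub continuous_const).measurable.coe_nnreal_ennreal
              · exact (f.continuous.mul (hg.min continuous_const)).measurable.coe_nnreal_ennreal
          _ ≤ _ := by gcongr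
      calc limsup (fun a => ∫⁻ x, (f x : ℝ≥0∞) * g x ∂(μs a : Measure X)) L
        _ ≤ limsup (fun a => ∫⁻ x, ((f x * min (g x) K : ℝ≥0) : ℝ≥0∞) ∂(μs a : Measure X)
              + C * ε) L := limsup_le_limsup hle
        _ = ∫⁻ x, ((f x * min (g x) K : ℝ≥0) : ℝ≥0∞) ∂(μ : Measure X) + C * ε :=
            ((hlim K).add tendsto_const_nhds).limsup_eq
        _ ≤ _ := by
            gcongr with x
            rw [← ENNReal.coe_mul]
            exact ENNReal.coe_le_coe.2 (mul_le_mul_right (min_le_left _ _) _)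
    refine ENNReal.le_of_forall_pos_le_add fun η hη _ => ?_
    -- The denominator is `C + 1` because `C` may vanish.
    refine (key (η / (C + 1) : ℝ≥0) (by positivity)).trans ?_
    gcongr
    rw [← ENNReal.coe_mul]
    have : C * (η / (C + 1)) ≤ η := by
      rw [mul_div_assoc', div_le_iff₀ (by positivity), mul_comm]
      gcongr
      exact le_self_add
    exact_mod_cast this

/-! ### Estimates within one experiment -/

namespace FinancialExperiment

section

variable {I : Set ℝ} {t₀ : I} {d : ℕ} {Ω : Type*} [MeasurableSpace Ω]
  (E : FinancialExperiment I t₀ d Ω)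

lemma measurable_Y_apply (t : I) (i : Fin d) : Measurable fun ω => E.Y ω t i :=
  (measurable_pi_apply i).comp ((measurable_pi_apply t).comp E.measurable_Y)

lemma Y_adapted (ht₀ : ∀ t, t₀ ≤ t) {s t : I} (hst : s ≤ t) :
    Measurable[E.filt t] fun ω => E.Y ω s := by
  refine @measurable_pi_lambda _ _ _ (E.filt t) _ _ fun i => ?_
  exact ((measurable_pi_apply i).comp ((E.adapted s).mono (E.filt.mono hst) le_rfl)).div
    ((measurable_pi_apply i).comp ((E.adapted t₀).mono (E.filt.mono (ht₀ t)) le_rfl))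

/-- Change of measure on `𝓕_t`. -/
lemma lintegral_Qi (ht₀ : ∀ t, t₀ ≤ t) (i : Fin d) (t : I) {f : Ω → ℝ≥0∞}
    (hf : Measurable[E.filt t] f) :
    ∫⁻ ω, f ω ∂(E.Qi i : Measure Ω) = ∫⁻ ω, f ω * E.Y ω t i ∂(E.Q : Measure Ω) := by
  have hY : Measurable[E.filt t] fun ω => (E.Y ω t i : ℝ≥0∞) :=
    ((measurable_pi_apply i).comp (E.Y_adapted ht₀ le_rfl)).coe_nnreal_ennreal
  rw [← lintegral_trim (E.filt.le t) hf, E.density i t]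
  change @lintegral _ (E.filt t)
    ((((E.Q : Measure Ω).trim (E.filt.le t))).withDensity fun ω => (E.Y ω t i : ℝ≥0∞)) f = _
  rw [@lintegral_withDensity_eq_lintegral_mul _ (E.filt t) _ _ hY _ hf,
    lintegral_trim (E.filt.le t) (hY.mul hf)]
  exact lintegral_congr fun ω => mul_comm _ _

lemma Qi_apply (ht₀ : ∀ t, t₀ ≤ t) (i : Fin d) (t : I) {A : Set Ω}
    (hA : MeasurableSet[E.filt t] A) :
    (E.Qi i : Measure Ω) A = ∫⁻ ω in A, E.Y ω t i ∂(E.Q : Measure Ω) := by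
  have h := E.lintegral_Qi ht₀ i t (f := A.indicator 1)
    ((@measurable_one _ _ _ (E.filt t) _).indicator hA)
  rw [lintegral_indicator_one (E.filt.le t A hA)] at h
  rw [h, ← lintegral_indicator (E.filt.le t A hA)]
  refine lintegral_congr fun ω => ?_
  by_cases hω : ω ∈ A <;> simp [hω]

lemma lintegral_Y (ht₀ : ∀ t, t₀ ≤ t) (i : Fin d) (t : I) :
    ∫⁻ ω, E.Y ω t i ∂(E.Q : Measure Ω) = 1 := by
  have h := E.Qi_apply ht₀ i t (@MeasurableSet.univ _ (E.filt t))
  rw [measure_univ, Measure.restrict_univ] at h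
  exact h.symm

/-- Markov's inequality with `Q`-mean 1. The bound does not depend on the experiment, which yields
tightness. -/
lemma Q_Y_gt_le (ht₀ : ∀ t, t₀ ≤ t) (i : Fin d) (t : I) {K : ℝ≥0} (hK : 0 < K) :
    (E.Q : Measure Ω) {ω | K < E.Y ω t i} ≤ (K⁻¹ : ℝ≥0) := by
  have h := meas_ge_le_lintegral_div (μ := (E.Q : Measure Ω))
    (E.measurable_Y_apply t i).coe_nnreal_ennreal.aemeasurable
    (ENNReal.coe_ne_zero.2 hK.ne') ENNReal.coe_ne_top
  rw [E.lintegral_Y ht₀, one_div, ← ENNReal.coe_inv hK.ne'] at h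
  refine (measure_mono fun ω hω => ?_).trans h
  exact ENNReal.coe_le_coe.2 (le_of_lt hω)

lemma measurableSet_Y_gt (ht₀ : ∀ t, t₀ ≤ t) (i : Fin d) (t : I) (K : ℝ≥0) :
    MeasurableSet[E.filt t] {ω | K < E.Y ω t i} :=
  ((measurable_pi_apply i).comp (E.Y_adapted ht₀ le_rfl)) measurableSet_Ioi

/-- The excess over `K` is at most `Y` on `{K < Y}`, and integrating `Y` over this event of `𝓕_t`
gives its `Q_i`-probability. Uniform integrability under `Q` thus becomes a tail bound under `Q_i`,
which contiguity supplies. -/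
lemma lintegral_Y_sub_le (ht₀ : ∀ t, t₀ ≤ t) (i : Fin d) (t : I) (K : ℝ≥0) :
    ∫⁻ ω, ((E.Y ω t i - K : ℝ≥0) : ℝ≥0∞) ∂(E.Q : Measure Ω) ≤
      (E.Qi i : Measure Ω) {ω | K < E.Y ω t i} := by
  have hA := E.measurableSet_Y_gt ht₀ i t K
  rw [E.Qi_apply ht₀ i t hA, ← lintegral_indicator (E.filt.le t _ hA)]
  refine lintegral_mono fun ω => ?_
  by_cases hω : K < E.Y ω t i
  · rw [Set.indicator_of_mem (show ω ∈ {ω | K < E.Y ω t i} from hω)]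
    exact ENNReal.coe_le_coe.2 tsub_le_self
  · simp [tsub_eq_zero_of_le (not_lt.1 hω)]

/-- The density of `Q_i` is below `δ` on this event. With `Q ◁ Q_i` the bound transfers to `Q` and
keeps mass away from 0. -/
lemma Qi_Y_lt_le (ht₀ : ∀ t, t₀ ≤ t) (i : Fin d) (t : I) (δ : ℝ≥0) :
    (E.Qi i : Measure Ω) {ω | E.Y ω t i < δ} ≤ δ := by
  have hA : MeasurableSet[E.filt t] {ω | E.Y ω t i < δ} :=
    ((measurable_pi_apply i).comp (E.Y_adapted ht₀ le_rfl)) measurableSet_Iio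
  rw [E.Qi_apply ht₀ i t hA]
  calc ∫⁻ ω in {ω | E.Y ω t i < δ}, E.Y ω t i ∂(E.Q : Measure Ω)
    _ ≤ ∫⁻ _ in {ω | E.Y ω t i < δ}, δ ∂(E.Q : Measure Ω) :=
        setLIntegral_mono' (E.filt.le t _ hA) fun ω hω =>
          ENNReal.coe_le_coe.2 (le_of_lt hω)
    _ ≤ δ := by
        rw [setLIntegral_const]
        exact mul_le_of_le_one_right' prob_le_one

lemma ae_Y_start (i : Fin d) : ∀ᵐ ω ∂(E.Q : Measure Ω), E.Y ω t₀ i = 1 := by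
  filter_upwards [E.price_pos t₀ i] with ω hω
  exact div_self hω.ne'

end

end FinancialExperiment

/-! ### Integrals against finite-dimensional marginals -/

section

variable {I : Set ℝ} {d : ℕ}

lemma lintegral_finMarginal (J : Finset I) (μ : ProbabilityMeasure (I → Fin d → ℝ≥0))
    {f : (J → Fin d → ℝ≥0) → ℝ≥0∞} (hf : Measurable f) :
    ∫⁻ y, f y ∂(finMarginal J μ : Measure (J → Fin d → ℝ≥0)) =
      ∫⁻ x, f (J.restrict x) ∂(μ : Measure (I → Fin d → ℝ≥0)) :=
  lintegral_map hf (Finset.measurable_restrict J)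

lemma FinancialExperiment.lintegral_finMarginal_lawY {t₀ : I} {Ω : Type*} [MeasurableSpace Ω]
    (E : FinancialExperiment I t₀ d Ω) (J : Finset I) (μ : ProbabilityMeasure Ω)
    {f : (J → Fin d → ℝ≥0) → ℝ≥0∞} (hf : Measurable f) :
    ∫⁻ y, f y ∂(finMarginal J (E.lawY μ) : Measure (J → Fin d → ℝ≥0)) =
      ∫⁻ ω, f (J.restrict (E.Y ω)) ∂(μ : Measure Ω) := by
  rw [lintegral_finMarginal J _ hf]
  exact lintegral_map (hf.comp (Finset.measurable_restrict J)) E.measurable_Y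

end

/-! ### Tightness and the limit law under `Q` -/

section

variable {I : Set ℝ} {t₀ : I} {d : ℕ} {Ω : ℕ → Type*} [∀ n, MeasurableSpace (Ω n)]
  (E : ∀ n, FinancialExperiment I t₀ d (Ω n))

lemma isTightMeasureSet_finMarginal_lawY (ht₀ : ∀ t, t₀ ≤ t) (J : Finset I) :
    IsTightMeasureSet {((μ : ProbabilityMeasure (J → Fin d → ℝ≥0)) :
      Measure (J → Fin d → ℝ≥0)) |
      μ ∈ Set.range fun n => finMarginal J ((E n).lawY (E n).Q)} := by
  rw [isTightMeasureSet_iff_exists_isCompact_measure_compl_le]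
  intro ε hε
  obtain ⟨K, hK0, hK⟩ : ∃ K : ℝ≥0, 0 < K ∧ (J.card * d * (K⁻¹ : ℝ≥0) : ℝ≥0∞) ≤ ε := by
    obtain ⟨η, hη0, hη⟩ := ENNReal.lt_iff_exists_nnreal_btwn.1 hε
    have hη0 : 0 < η := ENNReal.coe_pos.1 hη0
    -- The summand 1 keeps the radius positive when `J` is empty or `d = 0`.
    refine ⟨(J.card * d + 1) / η, by positivity, le_trans ?_ hη.le⟩
    have : (J.card * d * ((J.card * d + 1) / η)⁻¹ : ℝ≥0) ≤ η := by
      rw [inv_div, mul_div_assoc', div_le_iff₀ (by positivity), mul_comm]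
      gcongr
      exact le_self_add
    exact_mod_cast this
  refine ⟨Set.univ.pi fun _ => Set.univ.pi fun _ => Set.Icc 0 K,
    isCompact_univ_pi fun _ => isCompact_univ_pi fun _ => isCompact_Icc, ?_⟩
  rintro _ ⟨_, ⟨n, rfl⟩, rfl⟩
  have hmeas : MeasurableSet
      (Set.univ.pi fun _ : J => Set.univ.pi fun _ : Fin d => Set.Icc (0 : ℝ≥0) K) :=
    .univ_pi fun _ => .univ_pi fun _ => measurableSet_Icc
  have hlaw : (finMarginal J ((E n).lawY (E n).Q) : Measure (J → Fin d → ℝ≥0)) =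
      ((E n).Q : Measure (Ω n)).map fun ω => J.restrict ((E n).Y ω) :=
    Measure.map_map (Finset.measurable_restrict J) (E n).measurable_Y
  rw [hlaw, Measure.map_apply (by exact (Finset.measurable_restrict J).comp (E n).measurable_Y)
    hmeas.compl]
  calc ((E n).Q : Measure (Ω n)) _
    _ ≤ ((E n).Q : Measure (Ω n)) (⋃ t : J, ⋃ i : Fin d, {ω | K < (E n).Y ω t i}) := by
        refine measure_mono fun ω hω => ?_
        simp only [Set.mem_preimage, Set.mem_compl_iff, Set.mem_univ_pi, Set.mem_Icc, zero_le,
          true_and, not_forall, not_le] at hω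
        simpa using hω
    _ ≤ ∑ t : J, ∑ i : Fin d, ((E n).Q : Measure (Ω n)) {ω | K < (E n).Y ω t i} :=
        (measure_iUnion_fintype_le _ _).trans
          (Finset.sum_le_sum fun _ _ => measure_iUnion_fintype_le _ _)
    _ ≤ ∑ _t : J, ∑ _i : Fin d, ((K⁻¹ : ℝ≥0) : ℝ≥0∞) :=
        Finset.sum_le_sum fun t _ => Finset.sum_le_sum fun i _ => (E n).Q_Y_gt_le ht₀ i t hK0
    _ = J.card * d * (K⁻¹ : ℝ≥0) := by simp [mul_assoc]
    _ ≤ ε := hK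

/-- Along an ultrafilter the finite-dimensional laws of the normalised prices under the martingale
measures converge to those of one law on the path space. -/
theorem exists_tendsto_finMarginal_lawY (ht₀ : ∀ t, t₀ ≤ t) (U : Ultrafilter ℕ) :
    ∃ ν : ProbabilityMeasure (I → Fin d → ℝ≥0), ∀ J : Finset I,
      Tendsto (fun n => finMarginal J ((E n).lawY (E n).Q)) U (𝓝 (finMarginal J ν)) := by
  have hlim (J : Finset I) : ∃ P : ProbabilityMeasure (J → Fin d → ℝ≥0),
      Tendsto (fun n => finMarginal J ((E n).lawY (E n).Q)) U (𝓝 P) := by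
    obtain ⟨P, -, hP⟩ := (isCompact_closure_of_isTightMeasureSet
      (isTightMeasureSet_finMarginal_lawY E ht₀ J)).ultrafilter_le_nhds'
      (U.map fun n => finMarginal J ((E n).lawY (E n).Q))
      (Filter.Eventually.of_forall (f := (U : Filter ℕ))
        fun n => subset_closure (Set.mem_range_self n))
    exact ⟨P, hP⟩
  choose P hP using hlim
  have hproj : IsProjectiveMeasureFamily (α := fun _ : I => Fin d → ℝ≥0)
      fun J => (P J : Measure (J → Fin d → ℝ≥0)) := by
    intro J K hKJ
    have hc : Continuous (Finset.restrict₂ (π := fun _ : I => Fin d → ℝ≥0) hKJ) :=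
      Finset.continuous_restrict₂ hKJ
    have h1 := ProbabilityMeasure.tendsto_map_of_tendsto_of_continuous _ _ (hP J) hc
    have h2 : (fun n => (finMarginal J ((E n).lawY (E n).Q)).map hc.aemeasurable) =
        fun n => finMarginal K ((E n).lawY (E n).Q) := by
      funext n
      apply Subtype.ext
      exact Measure.map_map hc.measurable (Finset.measurable_restrict J)
    rw [h2] at h1
    -- Restriction is continuous, so the image of the limit on `J` and the limit on `K` are limits
    -- of the same laws.
    have h3 := tendsto_nhds_unique (hP K) h1
    exact congrArg ProbabilityMeasure.toMeasure h3
  obtain ⟨μ, hμ⟩ := exists_isProjectiveLimit hproj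
  refine ⟨⟨μ, hμ.isProbabilityMeasure⟩, fun J => ?_⟩
  have : finMarginal J ⟨μ, hμ.isProbabilityMeasure⟩ = P J := Subtype.ext (hμ J)
  rw [this]
  exact hP J

end

/-! ### Density, positivity and initial value in the limit -/

section

variable {I : Set ℝ} {t₀ : I} {d : ℕ} {Ω : ℕ → Type*} [∀ n, MeasurableSpace (Ω n)]
  {E : ∀ n, FinancialExperiment I t₀ d (Ω n)} {U : Filter ℕ}
  {ν : ProbabilityMeasure (I → Fin d → ℝ≥0)}

/-- Under contiguity, the laws of the normalised prices under `Q_i` converge at times up to `t`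
to the law with density `π^i_t` with respect to the limit under `Q`. -/
lemma tendsto_lintegral_finMarginal_Qi (ht₀ : ∀ t, t₀ ≤ t) (hU : U ≤ atTop)
    (hν : ∀ J : Finset I,
      Tendsto (fun n => finMarginal J ((E n).lawY (E n).Q)) U (𝓝 (finMarginal J ν)))
    {i : Fin d}
    (hc : Contiguous (fun n => ((E n).Qi i : Measure (Ω n))) fun n => ((E n).Q : Measure (Ω n)))
    {J : Finset I} {t : I} (hJ : ∀ s ∈ J, s ≤ t)
    (f : BoundedContinuousFunction (J → Fin d → ℝ≥0) ℝ≥0) :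
    Tendsto (fun n => ∫⁻ y, (f y : ℝ≥0∞) ∂(finMarginal J ((E n).lawY ((E n).Qi i)) :
        Measure (J → Fin d → ℝ≥0))) U
      (𝓝 (∫⁻ x, (f (J.restrict x) : ℝ≥0∞) * x t i ∂(ν : Measure (I → Fin d → ℝ≥0)))) := by
  classical
  -- Time `t` is added to `J` so that the density at `t` becomes a continuous function of the
  -- marginal.
  obtain ⟨J', htJ', hsub⟩ : ∃ J' : Finset I, t ∈ J' ∧ J ⊆ J' :=
    ⟨insert t J, Finset.mem_insert_self t J, Finset.subset_insert t J⟩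
  let g : (J' → Fin d → ℝ≥0) → ℝ≥0 :=
    fun y => y ⟨t, htJ'⟩ i
  have hg : Continuous g := by fun_prop
  have hr : Continuous (Finset.restrict₂ (π := fun _ : I => Fin d → ℝ≥0) hsub) :=
    Finset.continuous_restrict₂ hsub
  have hUI : ∀ ε : ℝ≥0∞, ε ≠ 0 → ∃ K : ℝ≥0, ∀ᶠ n in U,
      ∫⁻ y, ((g y - K : ℝ≥0) : ℝ≥0∞) ∂(finMarginal J' ((E n).lawY (E n).Q) :
        Measure (J' → Fin d → ℝ≥0)) ≤ ε := by
    intro ε hε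
    obtain ⟨δ, hδ0, hδ⟩ := hc.exists_forall_le hε
    -- At level `δ⁻¹` Markov's inequality gives the tail `Q`-probability at most `δ`, hence
    -- `Q_i`-probability at most `ε`.
    refine ⟨δ⁻¹, (hδ.filter_mono hU).mono fun n hn => ?_⟩
    rw [(E n).lintegral_finMarginal_lawY _ _
      (by exact (hg.sub continuous_const).measurable.coe_nnreal_ennreal)]
    refine ((E n).lintegral_Y_sub_le ht₀ i t δ⁻¹).trans (hn _ ?_ ?_)
    · exact (E n).filt.le t _ ((E n).measurableSet_Y_gt ht₀ i t _)
    · simpa using (E n).Q_Y_gt_le ht₀ i t (inv_pos.2 hδ0)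
  have key := tendsto_lintegral_mul_of_unifIntegrable (hν J') hg hUI
    (f.compContinuous ⟨_, hr⟩)
  have hm : Measurable fun y : J' → Fin d → ℝ≥0 =>
      ((f.compContinuous ⟨_, hr⟩) y : ℝ≥0∞) * g y :=
    (f.compContinuous ⟨_, hr⟩).continuous.measurable.coe_nnreal_ennreal.mul
      hg.measurable.coe_nnreal_ennreal
  rw [lintegral_finMarginal _ _ hm] at key
  refine key.congr fun n => ?_
  have hfm : Measurable[(E n).filt t] fun ω => (f (J.restrict ((E n).Y ω)) : ℝ≥0∞) := by
    refine (f.continuous.measurable.comp ?_).coe_nnreal_ennreal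
    exact @measurable_pi_lambda _ _ _ ((E n).filt t) _ _ fun s => (E n).Y_adapted ht₀ (hJ s s.2)
  rw [(E n).lintegral_finMarginal_lawY _ _ hm,
    (E n).lintegral_finMarginal_lawY _ _ f.continuous.measurable.coe_nnreal_ennreal,
    (E n).lintegral_Qi ht₀ i t hfm]
  rfl

/-- Almost sure properties of one coordinate do not pass to weak limits directly; they are tested
below with a ramp at 0 and a truncated distance to 1. -/
lemma tendsto_lintegral_Y_apply
    (hν : ∀ J : Finset I,
      Tendsto (fun n => finMarginal J ((E n).lawY (E n).Q)) U (𝓝 (finMarginal J ν)))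
    (t : I) (i : Fin d) {h : ℝ≥0 → ℝ≥0} (hh : Continuous h) (h1 : ∀ x, h x ≤ 1) :
    Tendsto (fun n => ∫⁻ ω, (h ((E n).Y ω t i) : ℝ≥0∞) ∂((E n).Q : Measure (Ω n))) U
      (𝓝 (∫⁻ x, (h (x t i) : ℝ≥0∞) ∂(ν : Measure (I → Fin d → ℝ≥0)))) := by
  have hc : Continuous fun y : ({t} : Finset I) → Fin d → ℝ≥0 =>
      h (y ⟨t, Finset.mem_singleton_self t⟩ i) := hh.comp (by fun_prop)
  let f : BoundedContinuousFunction (({t} : Finset I) → Fin d → ℝ≥0) ℝ≥0 :=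
    BoundedContinuousFunction.mkOfBound ⟨_, hc⟩ 1 fun x y => by
      have hx := NNReal.coe_le_coe.2 (h1 (x ⟨t, Finset.mem_singleton_self t⟩ i))
      have hy := NNReal.coe_le_coe.2 (h1 (y ⟨t, Finset.mem_singleton_self t⟩ i))
      simp only [NNReal.coe_one] at hx hy
      simp only [ContinuousMap.coe_mk, NNReal.dist_eq]
      rw [abs_le]
      constructor <;>
        linarith [NNReal.coe_nonneg (h (x ⟨t, Finset.mem_singleton_self t⟩ i)),
          NNReal.coe_nonneg (h (y ⟨t, Finset.mem_singleton_self t⟩ i))]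
  have key := ProbabilityMeasure.tendsto_iff_forall_lintegral_tendsto.1 (hν {t}) f
  rw [lintegral_finMarginal _ _ f.continuous.measurable.coe_nnreal_ennreal] at key
  refine key.congr fun n => ?_
  rw [(E n).lintegral_finMarginal_lawY _ _ f.continuous.measurable.coe_nnreal_ennreal]
  rfl

lemma ae_pos_of_contiguous [U.NeBot] (ht₀ : ∀ t, t₀ ≤ t) (hU : U ≤ atTop)
    (hν : ∀ J : Finset I,
      Tendsto (fun n => finMarginal J ((E n).lawY (E n).Q)) U (𝓝 (finMarginal J ν)))
    {i : Fin d}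
    (hc : Contiguous (fun n => ((E n).Q : Measure (Ω n))) fun n => ((E n).Qi i : Measure (Ω n)))
    (t : I) : ∀ᵐ x ∂(ν : Measure (I → Fin d → ℝ≥0)), 0 < x t i := by
  rw [ae_iff]
  refine le_antisymm (le_of_forall_gt fun ε hε => ?_) zero_le
  obtain ⟨η, hη0, hη⟩ := exists_between hε
  refine lt_of_le_of_lt ?_ hη
  obtain ⟨δ, hδ0, hδ⟩ := hc.exists_forall_le hη0.ne'
  -- With truncated subtraction this ramp lies between the indicators of `{0}` and `[0, δ)`, so it
  -- links the limit mass at 0 to the `Q`-probability of `{Y < δ}`.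
  have hh : Continuous fun x : ℝ≥0 => 1 - x / δ := by fun_prop
  have hlim := tendsto_lintegral_Y_apply hν t i hh fun x => tsub_le_self
  calc (ν : Measure (I → Fin d → ℝ≥0)) {x | ¬ 0 < x t i}
    _ ≤ ∫⁻ x, ((1 - x t i / δ : ℝ≥0) : ℝ≥0∞) ∂(ν : Measure (I → Fin d → ℝ≥0)) := by
        refine meas_le_lintegral₀ ?_ fun x hx => ?_
        · exact (hh.measurable.comp
            ((measurable_pi_apply i).comp (measurable_pi_apply t))).coe_nnreal_ennreal.aemeasurable
        · have : x t i = 0 := by simpa using hx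
          simp [this]
    _ ≤ η := by
        refine le_of_tendsto hlim ((hδ.filter_mono hU).mono fun n hn => ?_)
        have hm : MeasurableSet {ω | (E n).Y ω t i < δ} :=
          (E n).measurable_Y_apply t i measurableSet_Iio
        refine le_trans ?_ (hn _ hm ((E n).Qi_Y_lt_le ht₀ i t δ))
        rw [← lintegral_indicator_one hm]
        refine lintegral_mono fun ω => ?_
        by_cases hω : (E n).Y ω t i < δ
        · rw [Set.indicator_of_mem (show ω ∈ {ω | (E n).Y ω t i < δ} from hω)]
          exact ENNReal.coe_le_one_iff.2 tsub_le_self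
        · have : 1 ≤ (E n).Y ω t i / δ := (one_le_div₀ hδ0).2 (not_lt.1 hω)
          simp [tsub_eq_zero_of_le this]

lemma ae_start_eq_one [U.NeBot]
    (hν : ∀ J : Finset I,
      Tendsto (fun n => finMarginal J ((E n).lawY (E n).Q)) U (𝓝 (finMarginal J ν)))
    (i : Fin d) : ∀ᵐ x ∂(ν : Measure (I → Fin d → ℝ≥0)), x t₀ i = 1 := by
  have hh : Continuous fun x : ℝ≥0 => min (nndist x 1) 1 := by fun_prop
  have hlim := tendsto_lintegral_Y_apply hν t₀ i hh fun x => min_le_right _ _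
  have hzero n : ∫⁻ ω, ((min (nndist ((E n).Y ω t₀ i) 1) 1 : ℝ≥0) : ℝ≥0∞)
      ∂((E n).Q : Measure (Ω n)) = 0 := by
    rw [lintegral_congr_ae (g := fun _ => 0), lintegral_zero]
    filter_upwards [(E n).ae_Y_start i] with ω hω
    simp [hω]
  simp only [hzero] at hlim
  have h0 := (tendsto_nhds_unique hlim tendsto_const_nhds)
  rw [lintegral_eq_zero_iff (by exact (hh.measurable.comp
    ((measurable_pi_apply i).comp (measurable_pi_apply t₀))).coe_nnreal_ennreal)] at h0
  filter_upwards [h0] with x hx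
  have hx : min (nndist (x t₀ i) 1) 1 = 0 := ENNReal.coe_eq_zero.1 hx
  rcases min_eq_iff.1 hx with h | h
  · exact nndist_eq_zero.1 h.1
  · exact absurd h.1 one_ne_zero

end

/-! ### The canonical filtration on path space -/

section

variable {I : Set ℝ} {d : ℕ}

lemma measurable_coordFiltration {s t : I} (hst : s ≤ t) :
    Measurable[coordFiltration I d t] fun x : I → Fin d → ℝ≥0 => x s := by
  have h : MeasurableSpace.comap (fun x : I → Fin d → ℝ≥0 => x s) inferInstance ≤
      coordFiltration I d t := by
    exact le_iSup₂_of_le s hst le_rfl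
  exact (comap_measurable _).mono h le_rfl

lemma iSup_coordFiltration : ⨆ t, coordFiltration I d t = MeasurableSpace.pi := by
  refine le_antisymm (iSup_le fun t => (coordFiltration I d).le t) ?_
  refine iSup_le fun t => ?_
  exact (measurable_coordFiltration (le_refl t)).comap_le.trans
    (le_iSup (fun t => (coordFiltration I d t : MeasurableSpace (I → Fin d → ℝ≥0))) t)

/-- Finite measures that agree on the finite-dimensional marginals at times up to `t` agree on
`𝓖_t`. -/
lemma trim_coordFiltration_eq {μ₁ μ₂ : Measure (I → Fin d → ℝ≥0)} [IsFiniteMeasure μ₁]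
    {t : I} (h : ∀ J : Finset I, (∀ s ∈ J, s ≤ t) → μ₁.map J.restrict = μ₂.map J.restrict) :
    μ₁.trim ((coordFiltration I d).le t) = μ₂.trim ((coordFiltration I d).le t) := by
  have hgen : (coordFiltration I d t : MeasurableSpace (I → Fin d → ℝ≥0)) =
      .generateFrom (piiUnionInter (fun s : I => {A | MeasurableSet[MeasurableSpace.comap
        (fun x : I → Fin d → ℝ≥0 => x s) inferInstance] A}) {s | s ≤ t}) :=
    (generateFrom_piiUnionInter_measurableSet _ _).symm
  have hcyl : ∀ J : Finset I, (∀ s ∈ J, s ≤ t) → ∀ S : Set (J → Fin d → ℝ≥0),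
      MeasurableSet S → μ₁ (J.restrict ⁻¹' S) = μ₂ (J.restrict ⁻¹' S) := by
    intro J hJ S hS
    rw [← Measure.map_apply (Finset.measurable_restrict J) hS, h J hJ,
      Measure.map_apply (Finset.measurable_restrict J) hS]
  have : IsFiniteMeasure (μ₁.trim ((coordFiltration I d).le t)) := isFiniteMeasure_trim _
  refine @ext_of_generate_finite _ (coordFiltration I d t) _ _ _ hgen
    (isPiSystem_piiUnionInter _ (fun s => @MeasurableSpace.isPiSystem_measurableSet _
      (MeasurableSpace.comap (fun x : I → Fin d → ℝ≥0 => x s) inferInstance)) _) this ?_ ?_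
  · rintro A hA
    have mA : MeasurableSet[coordFiltration I d t] A := by
      rw [hgen]
      exact MeasurableSpace.measurableSet_generateFrom hA
    rw [trim_measurableSet_eq _ mA, trim_measurableSet_eq _ mA]
    obtain ⟨J, hJ, f, hf, rfl⟩ := hA
    choose! B hB hBf using show ∀ s ∈ J, ∃ B : Set (Fin d → ℝ≥0), MeasurableSet B ∧
      (fun x : I → Fin d → ℝ≥0 => x s) ⁻¹' B = f s from hf
    have hA : ⋂ s ∈ J, f s = J.restrict ⁻¹' (Set.univ.pi fun s : J => B s) := by
      ext x
      simp only [Set.mem_iInter, Set.mem_preimage, Set.mem_univ_pi, Finset.forall_coe]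
      refine forall₂_congr fun s hs => ?_
      rw [← hBf s hs]
      rfl
    rw [hA]
    refine hcyl J (fun s hs => hJ hs) _ (.univ_pi fun s => hB s s.2)
  -- Equality of total masses is the case `J = ∅`.
  · rw [trim_measurableSet_eq _ .univ, trim_measurableSet_eq _ .univ]
    simpa using hcyl ∅ (by simp) Set.univ .univ

/-- A law on the path space under which the initial value is constant is trivial on `𝓖_0`. -/
lemma coordFiltration_start_trivial {t₀ : I} (ht₀ : ∀ t, t₀ ≤ t)
    {ν : Measure (I → Fin d → ℝ≥0)} [IsProbabilityMeasure ν] {c : Fin d → ℝ≥0}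
    (h : ∀ᵐ x ∂ν, x t₀ = c) {A : Set (I → Fin d → ℝ≥0)}
    (hA : MeasurableSet[coordFiltration I d t₀] A) : ν A = 0 ∨ ν A = 1 := by
  -- As `t₀` is the least time, `𝓖_{t₀}` is generated by the single coordinate `x t₀`.
  have hle : (coordFiltration I d t₀ : MeasurableSpace (I → Fin d → ℝ≥0)) ≤
      MeasurableSpace.comap (fun x : I → Fin d → ℝ≥0 => x t₀) inferInstance :=
    iSup₂_le fun s hs => by
      obtain rfl := le_antisymm hs (ht₀ s)
      exact le_rfl
  obtain ⟨B, -, rfl⟩ := hle A hA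
  by_cases hc : c ∈ B
  · right
    refine (measure_congr (eventuallyEq_univ.2 ?_)).trans measure_univ
    filter_upwards [h] with x hx
    rwa [Set.mem_preimage, hx]
  · left
    refine measure_mono_null (fun x hx => ?_) (ae_iff.1 h)
    rintro rfl
    exact hc hx

end

/-! ### Construction of the standard experiment -/

section

variable {I : Set ℝ} {t₀ : I} {d : ℕ}

/-- The standard financial experiment on the path space attached to a law `ν`, whose measures `ν_i`
have the densities `π^i_T` at the terminal time `T`. -/
noncomputable def standardExperiment (ht₀ : ∀ t, t₀ ≤ t) (T : I)
    (ν : ProbabilityMeasure (I → Fin d → ℝ≥0))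
    (hpos : ∀ t i, ∀ᵐ x ∂(ν : Measure (I → Fin d → ℝ≥0)), 0 < x t i)
    (hstart : ∀ i, ∀ᵐ x ∂(ν : Measure (I → Fin d → ℝ≥0)), x t₀ i = 1)
    (hone : ∀ i, ∫⁻ x, (x T i : ℝ≥0∞) ∂(ν : Measure (I → Fin d → ℝ≥0)) = 1)
    (hdens : ∀ i t, ((ν : Measure (I → Fin d → ℝ≥0)).withDensity
        fun x => (x T i : ℝ≥0∞)).trim ((coordFiltration I d).le t) =
      ((ν : Measure (I → Fin d → ℝ≥0)).trim ((coordFiltration I d).le t)).withDensity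
        fun x => (x t i : ℝ≥0∞)) :
    FinancialExperiment I t₀ d (I → Fin d → ℝ≥0) where
  filt := coordFiltration I d
  iSup_filt := iSup_coordFiltration
  price t x := x t
  adapted t := measurable_coordFiltration le_rfl
  Qi i := ⟨(ν : Measure (I → Fin d → ℝ≥0)).withDensity fun x => (x T i : ℝ≥0∞),
    ⟨by rw [withDensity_apply _ .univ, Measure.restrict_univ, hone i]⟩⟩
  Q := ν
  price_pos := hpos
  trivial_start _ hA := coordFiltration_start_trivial ht₀ (c := fun _ => 1)
    ((ae_all_iff.2 hstart).mono fun _ hx => funext hx) hA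
  ac i := withDensity_absolutelyContinuous _ _
  density i t := by
    have h1 : Measurable[coordFiltration I d t] fun x : I → Fin d → ℝ≥0 => x t i :=
      (measurable_pi_apply i).comp (measurable_coordFiltration le_rfl)
    have h2 : Measurable[coordFiltration I d t] fun x : I → Fin d → ℝ≥0 => x t₀ i :=
      (measurable_pi_apply i).comp (measurable_coordFiltration (ht₀ t))
    refine (hdens i t).trans ?_
    rw [← trim_withDensity _ h1.coe_nnreal_ennreal,
      ← trim_withDensity _ (by exact (h1.div h2).coe_nnreal_ennreal)]
    -- The structure asks for the density `x t i / x t₀ i`, and its denominator is ν-a.s. 1.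
    congr 1
    refine withDensity_congr_ae ?_
    filter_upwards [hstart i] with x hx
    rw [hx, div_one]

end

/-! ### From ultrafilters to subnets -/

/-- The pairs `(A, n)` with `n ∈ A ∈ U`, directed by reverse inclusion of `A`. -/
def UltrafilterIndex (U : Ultrafilter ℕ) : Type := {p : Set ℕ × ℕ // p.1 ∈ U ∧ p.2 ∈ p.1}

instance (U : Ultrafilter ℕ) : Preorder (UltrafilterIndex U) where
  le p q := q.1.1 ⊆ p.1.1
  le_refl _ := subset_rfl
  le_trans _ _ _ hpq hqr := hqr.trans hpq

/-- Every ultrafilter on `ℕ` finer than `atTop` contains the tail filter of a subnet. -/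
lemma exists_subnet_tendsto_ultrafilter {U : Ultrafilter ℕ} (hU : (U : Filter ℕ) ≤ atTop) :
    ∃ (D : Type) (_ : Preorder D) (_ : Nonempty D) (_ : IsDirectedOrder D) (φ : D → ℕ),
      IsSubnet φ ∧ Tendsto φ atTop U := by
  let D := UltrafilterIndex U
  have hle (p q : D) : p ≤ q ↔ q.1.1 ⊆ p.1.1 := Iff.rfl
  have hmk (A : Set ℕ) (hA : A ∈ U) : ∃ p : D, p.1.1 = A := by
    obtain ⟨n, hn⟩ := U.nonempty_of_mem hA
    exact ⟨⟨(A, n), hA, hn⟩, rfl⟩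
  have hne : Nonempty D := ⟨(hmk Set.univ univ_mem).choose⟩
  have hdir : IsDirectedOrder D := ⟨fun p q => by
    obtain ⟨r, hr⟩ := hmk _ (inter_mem p.2.1 q.2.1)
    refine ⟨r, (hle _ _).2 ?_, (hle _ _).2 ?_⟩
    · rw [hr]
      exact Set.inter_subset_left
    · rw [hr]
      exact Set.inter_subset_right⟩
  -- Any pair beyond one with set `A` has its set inside `A`, and so its integer in `A`; the
  -- integers themselves play no role in the order.
  have hev (A : Set ℕ) (hA : A ∈ U) : ∃ a : D, ∀ b, a ≤ b → b.1.2 ∈ A := by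
    obtain ⟨a, rfl⟩ := hmk A hA
    exact ⟨a, fun b hab => hab b.2.2⟩
  refine ⟨D, inferInstance, hne, hdir, fun p => p.1.2, fun m => hev _ (hU (Ici_mem_atTop m)), ?_⟩
  intro A hA
  obtain ⟨a, ha⟩ := hev A hA
  exact mem_atTop_sets.2 ⟨a, ha⟩

/-! ### The main theorem -/

theorem mainTheorem6 (I : Set ℝ) (T : ℝ) (hI : I ⊆ Set.Icc 0 T) (h0 : (0 : ℝ) ∈ I) (hT : T ∈ I)
    (d : ℕ) (Ω : ℕ → Type*) [∀ n, MeasurableSpace (Ω n)]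
    (E : ∀ n, FinancialExperiment I ⟨0, h0⟩ d (Ω n))
    (hcont : ∀ i : Fin d,
      Contiguous (fun n => ((E n).Qi i : Measure (Ω n))) (fun n => ((E n).Q : Measure (Ω n))) ∧
      Contiguous (fun n => ((E n).Q : Measure (Ω n))) (fun n => ((E n).Qi i : Measure (Ω n)))) :
    ∃ S : FinancialExperiment I ⟨0, h0⟩ d (I → Fin d → ℝ≥0), S.IsStandard ∧
      ∃ (D : Type) (_ : Preorder D) (_ : Nonempty D) (_ : IsDirectedOrder D) (φ : D → ℕ),
        IsSubnet φ ∧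
        ∀ J : Finset I,
          (∀ i : Fin d, Tendsto (fun τ => finMarginal J ((E (φ τ)).lawY ((E (φ τ)).Qi i))) atTop
            (𝓝 (finMarginal J (S.Qi i)))) ∧
          Tendsto (fun τ => finMarginal J ((E (φ τ)).lawY (E (φ τ)).Q)) atTop
            (𝓝 (finMarginal J S.Q)) := by
  have ht₀ : ∀ t : I, (⟨0, h0⟩ : I) ≤ t := fun t => (hI t.2).1
  have htT : ∀ t : I, t ≤ ⟨T, hT⟩ := fun t => (hI t.2).2
  have hU : (hyperfilter ℕ : Filter ℕ) ≤ atTop := Nat.hyperfilter_le_atTop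
  obtain ⟨ν, hν⟩ := exists_tendsto_finMarginal_lawY E ht₀ (hyperfilter ℕ)
  have hlim (i : Fin d) {J : Finset I} {t : I} (hJ : ∀ s ∈ J, s ≤ t)
      (f : BoundedContinuousFunction (J → Fin d → ℝ≥0) ℝ≥0) :=
    tendsto_lintegral_finMarginal_Qi ht₀ hU hν (hcont i).1 hJ f
  have hmeas (i : Fin d) (t : I) :
      Measurable fun x : I → Fin d → ℝ≥0 => (x t i : ℝ≥0∞) :=
    ((measurable_pi_apply i).comp (measurable_pi_apply t)).coe_nnreal_ennreal
  have hone (i : Fin d) (t : I) :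
      ∫⁻ x, (x t i : ℝ≥0∞) ∂(ν : Measure (I → Fin d → ℝ≥0)) = 1 := by
    -- With `J = ∅` and `f = 1` the converging integrals are the total masses of the `Q_i`, so no
    -- mass is lost.
    have h := hlim i (J := ∅) (t := t) (by simp) 1
    simp only [BoundedContinuousFunction.coe_one, Pi.one_apply, ENNReal.coe_one, one_mul,
      lintegral_one, measure_univ] at h
    exact tendsto_nhds_unique h tendsto_const_nhds
  have hprob (i : Fin d) (t : I) : IsProbabilityMeasure
      ((ν : Measure (I → Fin d → ℝ≥0)).withDensity fun x => (x t i : ℝ≥0∞)) :=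
    ⟨by rw [withDensity_apply _ .univ, Measure.restrict_univ, hone i t]⟩
  have hmap (i : Fin d) (t : I) (J : Finset I)
      (f : BoundedContinuousFunction (J → Fin d → ℝ≥0) ℝ≥0) :
      ∫⁻ y, f y ∂(((ν : Measure (I → Fin d → ℝ≥0)).withDensity
          fun x => (x t i : ℝ≥0∞)).map J.restrict) =
        ∫⁻ x, (f (J.restrict x) : ℝ≥0∞) * x t i ∂(ν : Measure (I → Fin d → ℝ≥0)) := by
    have hf := f.continuous.measurable.coe_nnreal_ennreal
    rw [lintegral_map hf (Finset.measurable_restrict J),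
      lintegral_withDensity_eq_lintegral_mul _ (hmeas i t)
        (by exact hf.comp (Finset.measurable_restrict J))]
    simp only [Pi.mul_apply, mul_comm]
  have hdens (i : Fin d) (t : I) : ((ν : Measure (I → Fin d → ℝ≥0)).withDensity
        fun x => (x ⟨T, hT⟩ i : ℝ≥0∞)).trim ((coordFiltration I d).le t) =
      ((ν : Measure (I → Fin d → ℝ≥0)).trim ((coordFiltration I d).le t)).withDensity
        fun x => (x t i : ℝ≥0∞) := by
    have hm : Measurable[coordFiltration I d t] fun x : I → Fin d → ℝ≥0 => (x t i : ℝ≥0∞) :=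
      ((measurable_pi_apply i).comp (measurable_coordFiltration le_rfl)).coe_nnreal_ennreal
    rw [← trim_withDensity _ hm]
    refine trim_coordFiltration_eq fun J hJ => ?_
    have := Measure.isFiniteMeasure_map ((ν : Measure (I → Fin d → ℝ≥0)).withDensity
      fun x => (x ⟨T, hT⟩ i : ℝ≥0∞)) J.restrict
    refine ext_of_forall_lintegral_eq_of_IsFiniteMeasure fun f => ?_
    rw [hmap, hmap]
    -- Both sides are limits of the same `Q_i`-integrals, with the density read at time `T` and at
    -- time `t`.
    exact tendsto_nhds_unique (hlim i (fun s _ => htT s) f) (hlim i hJ f)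
  let S := standardExperiment ht₀ ⟨T, hT⟩ ν
    (fun t i => ae_pos_of_contiguous ht₀ hU hν (hcont i).2 t)
    (fun i => ae_start_eq_one hν i) (fun i => hone i _) hdens
  obtain ⟨D, _, hne, hdir, φ, hφ, hφU⟩ := exists_subnet_tendsto_ultrafilter hU
  refine ⟨S, ⟨rfl, rfl, hdens⟩, D, _, hne, hdir, φ, hφ, fun J => ⟨fun i => ?_, ?_⟩⟩
  · have hQi : Tendsto (fun n => finMarginal J ((E n).lawY ((E n).Qi i))) (hyperfilter ℕ)
        (𝓝 (finMarginal J (S.Qi i))) := by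
      refine ProbabilityMeasure.tendsto_iff_forall_lintegral_tendsto.2 fun f => ?_
      -- Every `J` lies before `T`, so the terminal density identifies the limit of all marginals.
      have h := hlim i (t := ⟨T, hT⟩) (fun s _ => htT s) f
      rw [← hmap] at h
      exact h
    exact hQi.comp hφU
  · exact (hν J).comp hφU
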